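/- Let $\{|\psi_1\rangle,\dots,|\psi_K\rangle\}$ be pairwise orthogonal unit vectors shared by two parties, Alice and Bob. \emph{Perfect LSD} (local state discrimination) means that some LOCC protocol (local measurements and classical communication) identifies with certainty the state $|\psi_i\rangle$ of which one copy is given. \emph{Perfect LSM} (local state marking) means that some LOCC protocol identifies with certainty the order in which all $K$ states are given, i.e. it finds the permutation $f$ of $\{1,\dots,K\}$ from $|\psi_{f(1)}\rangle\otimes\cdots\otimes|\psi_{f(K)}\rangle$. Theorem. Perfect LSM of a set of pairwise orthogonal states does not in general imply perfect LSD of the set. In particular, let $$|\phi^\pm\rangle=\tfrac{1}{\sqrt2}(|00\rangle\pm|11\rangle),\qquad |\psi^\pm\rangle=\tfrac{1}{\sqrt2}(|01\rangle\pm|10\rangle),$$ and let $\mathcal X_4=\{|\chi_1\rangle,|\chi_2\rangle,|\chi_3\rangle,|\chi_4\rangle\}\subset\mathbb C^4\otimes\mathbb C^4$ with $$|\chi_1\rangle=|\phi^+\rangle_{A_1B_1}|\phi^+\rangle_{A_2B_2},\quad |\chi_2\rangle=|\phi^-\rangle_{A_1B_1}|\phi^-\rangle_{A_2B_2},\quad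 |\chi_3\rangle=|\psi^+\rangle_{A_1B_1}|\phi^-\rangle_{A_2B_2},\quad |\chi_4\rangle=|\psi^-\rangle_{A_1B_1}|\phi^-\rangle_{A_2B_2},$$ where Alice holds $A_1A_2$ and Bob holds $B_1B_2$. Then: 1. The four states are orthonormal, and $\mathcal X_4$ admits perfect LSM. Moreover there is a finite-round LOCC protocol that marks all four states with certainty and in each of its branches leaves Alice and Bob with a whole number of ebits (a state that is, up to local isometries, $n$ EPR pairs $|\phi^+\rangle^{\otimes n}$), this number being 3 on average over the outcomes of the protocol and over the 24 equally likely orders of the four states. 2. $\mathcal X_4$ does not admit perfect LSD. Indeed, its states cannot be distinguished perfectly even by a PPT POVM, i.e. a POVM on $\mathbb C^4\otimes\mathbb C^4$ all of whose elements have a positive semidefinite partial transpose. -/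

import Mathlib

open scoped Matrix Kronecker ComplexOrder

noncomputable section

/-! Pure states shared by Alice and Bob are coordinate vectors `A × B → ℂ`, where the finite types
`A` and `B` index orthonormal bases of the two local Hilbert spaces. -/

/-- The squared norm of a vector. -/
def vecNormSq {I : Type} [Fintype I] (ψ : I → ℂ) : ℝ := ∑ i, Complex.normSq (ψ i)

/-- `ψ` is a family of pairwise orthogonal unit vectors. -/
def IsOrthonormalFamily {X I : Type} [Fintype I] (ψ : X → I → ℂ) : Prop :=
  (∀ x, star (ψ x) ⬝ᵥ ψ x = 1) ∧ ∀ x y, x ≠ y → star (ψ x) ⬝ᵥ ψ y = 0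

/-- The vector `(K ⊗ 1) ψ`. -/
def applyAlice {A A' B : Type} [Fintype A] (K : Matrix A' A ℂ) (ψ : A × B → ℂ) : A' × B → ℂ :=
  fun x => ∑ a, K x.1 a * ψ (a, x.2)

/-- The vector `(1 ⊗ K) ψ`. -/
def applyBob {A B B' : Type} [Fintype B] (K : Matrix B' B ℂ) (ψ : A × B → ℂ) : A × B' → ℂ :=
  fun x => ∑ b, K x.2 b * ψ (x.1, b)

/-- A (finite-round) LOCC protocol with final verdicts in `X`, for two parties who hold systems with
basis labels `A` and `B`. In each round one party performs a quantum measurement on the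
own system, given by Kraus operators `K i` with `∑ i, (K i)ᴴ * K i = 1` (the output system may
differ from the input system, so that ancillas can be added and subsystems discarded), and announces
the outcome `i`; the remaining protocol may depend on all outcomes announced so far. -/
inductive LOCC (X : Type) : Type → Type → Type 1
  | done {A B : Type} (x : X) : LOCC X A B
  | alice {A B : Type} (A' : Type) [DecidableEq A] [Fintype A'] (n : ℕ)
      (K : Fin n → Matrix A' A ℂ) (hK : ∑ i, (K i)ᴴ * K i = 1)
      (next : Fin n → LOCC X A' B) : LOCC X A B
  | bob {A B : Type} (B' : Type) [DecidableEq B] [Fintype B'] (n : ℕ)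
      (K : Fin n → Matrix B' B ℂ) (hK : ∑ i, (K i)ᴴ * K i = 1)
      (next : Fin n → LOCC X A B') : LOCC X A B

/-- The probability that the protocol, run on the unit vector `ψ`, ends with the verdict `x`.
(In the recursion `ψ` is the unnormalized state of a branch: its squared norm is the
probability of the branch.) -/
def LOCC.prob {X : Type} [DecidableEq X] (x : X) : {A B : Type} → [Fintype A] → [Fintype B] →
    LOCC X A B → (A × B → ℂ) → ℝ
  | _, _, _, _, .done y, ψ => if y = x then vecNormSq ψ else 0
  | _, _, _, _, @LOCC.alice _ _ _ _ _ _ _ K _ next, ψ => ∑ i, LOCC.prob x (next i) (applyAlice (K i) ψ)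
  | _, _, _, _, @LOCC.bob _ _ _ _ _ _ _ K _ next, ψ => ∑ i, LOCC.prob x (next i) (applyBob (K i) ψ)

/-- The protocol identifies each member of the family `ψ` of states with certainty. -/
def LOCC.Identifies {X A B : Type} [DecidableEq X] [Fintype A] [Fintype B]
    (p : LOCC X A B) (ψ : X → A × B → ℂ) : Prop :=
  ∀ x, p.prob x (ψ x) = 1

/-- `n` EPR pairs `(|00⟩ + |11⟩)/√2`, the first qubits with Alice and the second ones with Bob. -/
def eprPairs (n : ℕ) : (Fin n → Fin 2) × (Fin n → Fin 2) → ℂ :=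
  fun x => if x.1 = x.2 then ((Real.sqrt 2 : ℂ)⁻¹) ^ n else 0

/-- Up to a scalar, `ψ` is `n` ebits: `n` EPR pairs embedded by local isometries `V` and `W`. -/
def IsEbits {A B : Type} [Fintype A] [Fintype B] (n : ℕ) (ψ : A × B → ℂ) : Prop :=
  ∃ (V : Matrix A (Fin n → Fin 2) ℂ) (W : Matrix B (Fin n → Fin 2) ℂ) (c : ℂ),
    Vᴴ * V = 1 ∧ Wᴴ * W = 1 ∧ ψ = c • ((V ⊗ₖ W) *ᵥ eprPairs n)

/-- Run on the unit vector `ψ`, the protocol ends in every branch (of nonzero probability) with Alice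
and Bob sharing a whole number of ebits, and `c` is the average of this number over the branches. -/
def LOCC.LeavesEbits {X : Type} : {A B : Type} → [Fintype A] → [Fintype B] →
    LOCC X A B → (A × B → ℂ) → ℝ → Prop
  | _, _, _, _, .done _, ψ, c =>
      (ψ = 0 ∧ c = 0) ∨ ∃ n : ℕ, IsEbits n ψ ∧ c = vecNormSq ψ * n
  | _, _, _, _, @LOCC.alice _ _ _ _ _ _ n K _ next, ψ, c =>
      ∃ d : Fin n → ℝ, c = ∑ i, d i ∧ ∀ i, LOCC.LeavesEbits (next i) (applyAlice (K i) ψ) (d i)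
  | _, _, _, _, @LOCC.bob _ _ _ _ _ _ n K _ next, ψ, c =>
      ∃ d : Fin n → ℝ, c = ∑ i, d i ∧ ∀ i, LOCC.LeavesEbits (next i) (applyBob (K i) ψ) (d i)

/-- Perfect local state discrimination: one copy of an unknown member of the family is identified
with certainty by LOCC. -/
def PerfectLSD {X A B : Type} [DecidableEq X] [Fintype A] [Fintype B]
    (ψ : X → A × B → ℂ) : Prop :=
  ∃ p : LOCC X A B, p.Identifies ψ

/-- The state `ψ_{f 1} ⊗ ⋯ ⊗ ψ_{f m}` of `m` different members of the family `ψ`, with Alice holding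
the `A` parts and Bob the `B` parts. -/
def markingState {A B : Type} {k m : ℕ} (ψ : Fin k → A × B → ℂ) (f : Fin m ↪ Fin k) :
    (Fin m → A) × (Fin m → B) → ℂ :=
  fun x => ∏ j, ψ (f j) (x.1 j, x.2 j)

/-- Perfect `m`-LSM: `m` different members of the family, in an unknown choice and order, are all
identified with certainty by LOCC. -/
def PerfectMarking (m : ℕ) {A B : Type} [Fintype A] [Fintype B] {k : ℕ}
    (ψ : Fin k → A × B → ℂ) : Prop :=
  PerfectLSD (markingState (m := m) ψ)

/-- Perfect LSM: all `k` members of the family are given, in an unknown order. -/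
def PerfectLSM {A B : Type} [Fintype A] [Fintype B] {k : ℕ} (ψ : Fin k → A × B → ℂ) : Prop :=
  PerfectMarking k ψ

/-- The partial transpose (on Bob's side). -/
def partialTranspose {A B : Type} (M : Matrix (A × B) (A × B) ℂ) : Matrix (A × B) (A × B) ℂ :=
  Matrix.of fun x y => M (x.1, y.2) (y.1, x.2)

/-- The family `ψ` of unit vectors is perfectly distinguished by some POVM all of whose elements have
a positive semidefinite partial transpose. -/
def PPTDistinguishable {X A B : Type} [Fintype X] [Fintype A] [Fintype B]
    [DecidableEq A] [DecidableEq B] (ψ : X → A × B → ℂ) : Prop :=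
  ∃ M : X → Matrix (A × B) (A × B) ℂ,
    (∀ x, (M x).PosSemidef) ∧ (∀ x, (partialTranspose (M x)).PosSemidef) ∧ ∑ x, M x = 1 ∧
      ∀ x, star (ψ x) ⬝ᵥ (M x *ᵥ ψ x) = 1

/-- The Bell state `(|00⟩ + |11⟩)/√2`. -/
def phiPlus : Fin 2 × Fin 2 → ℂ :=
  fun x => if x = (0, 0) then (Real.sqrt 2 : ℂ)⁻¹ else if x = (1, 1) then (Real.sqrt 2 : ℂ)⁻¹ else 0

/-- The Bell state `(|00⟩ - |11⟩)/√2`. -/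
def phiMinus : Fin 2 × Fin 2 → ℂ :=
  fun x => if x = (0, 0) then (Real.sqrt 2 : ℂ)⁻¹ else if x = (1, 1) then -(Real.sqrt 2 : ℂ)⁻¹ else 0

/-- The Bell state `(|01⟩ + |10⟩)/√2`. -/
def psiPlus : Fin 2 × Fin 2 → ℂ :=
  fun x => if x = (0, 1) then (Real.sqrt 2 : ℂ)⁻¹ else if x = (1, 0) then (Real.sqrt 2 : ℂ)⁻¹ else 0

/-- The Bell state `(|01⟩ - |10⟩)/√2`. -/
def psiMinus : Fin 2 × Fin 2 → ℂ :=
  fun x => if x = (0, 1) then (Real.sqrt 2 : ℂ)⁻¹ else if x = (1, 0) then -(Real.sqrt 2 : ℂ)⁻¹ else 0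

/-- `β₁` on the qubits `A₁B₁` tensor `β₂` on the qubits `A₂B₂`; Alice holds `A₁A₂`, Bob `B₁B₂`. -/
def twoPairs (β₁ β₂ : Fin 2 × Fin 2 → ℂ) : (Fin 2 × Fin 2) × (Fin 2 × Fin 2) → ℂ :=
  fun x => β₁ (x.1.1, x.2.1) * β₂ (x.1.2, x.2.2)

/-- The four states of the set `𝒳₄` in `ℂ⁴ ⊗ ℂ⁴`. -/
def chi : Fin 4 → (Fin 2 × Fin 2) × (Fin 2 × Fin 2) → ℂ :=
  ![twoPairs phiPlus phiPlus, twoPairs phiMinus phiMinus,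
    twoPairs psiPlus phiMinus, twoPairs psiMinus phiMinus]

end

/-! `chi` itself is the counterexample to "LSM implies LSD". Discrimination: the verdict of an LOCC
protocol is a POVM whose elements have positive partial transpose (`LOCC.exists_ppt_povm`). The
partial transpose of a Bell projector is diagonal in the Bell basis, so PPT becomes a system of
linear inequalities on the diagonal entries of the elements in the basis of products of Bell states.
A nonnegative combination of these bounds the sum of the four success probabilities by 7/2 < 4
(`false_of_bell_weights`). Marking: each arrangement gives a maximally entangled state of eight
qubit pairs, changed by bit flips and phases only. Each party reads three parities in the
computational basis and two bits in the conjugate basis. The sum of both outcomes is a five-bit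
syndrome that separates the 24 arrangements (`markSyndrome_injective`), and the three unmeasured
qubits stay maximally entangled (`applyBob_applyAlice_markingState`). -/

noncomputable section

/-! ### Bell-diagonal weights and the PPT obstruction -/

/-- The four Bell states. -/
def bell : Fin 4 → Fin 2 × Fin 2 → ℂ := ![phiPlus, phiMinus, psiPlus, psiMinus]

lemma inv_sqrt_two_mul_self : (Real.sqrt 2 : ℂ)⁻¹ * (Real.sqrt 2 : ℂ)⁻¹ = 1 / 2 := by
  rw [← mul_inv, ← Complex.ofReal_mul, Real.mul_self_sqrt (by norm_num)]
  norm_num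

lemma star_bell (u : Fin 4) (x : Fin 2 × Fin 2) : star (bell u x) = bell u x := by
  obtain ⟨a, b⟩ := x
  fin_cases u <;> fin_cases a <;> fin_cases b <;>
    simp [bell, phiPlus, phiMinus, psiPlus, psiMinus]

lemma sum_bell_mul_bell (u v : Fin 4) :
    ∑ x, bell u x * bell v x = if u = v then 1 else 0 := by
  fin_cases u <;> fin_cases v <;>
    simp [bell, phiPlus, phiMinus, psiPlus, psiMinus, Fintype.sum_prod_type,
      inv_sqrt_two_mul_self, -mul_inv_rev] <;> norm_num

/-- The sign relating the projector of one Bell state to the partial transpose of another. -/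
def bellSign (a u : Fin 4) : ℝ := if (a : ℕ) + u = 3 then -1 else 1

/-- The partial transpose of a Bell projector is half the identity minus the projector onto Bell
state `3 - a`; the Bell basis resolves the identity. -/
lemma bell_partialTranspose (a : Fin 4) (x y : Fin 2 × Fin 2) :
    bell a (x.1, y.2) * bell a (y.1, x.2) =
      1 / 2 * ∑ u, (bellSign a u : ℂ) * (bell u x * bell u y) := by
  obtain ⟨x₁, x₂⟩ := x
  obtain ⟨y₁, y₂⟩ := y
  fin_cases a <;> fin_cases x₁ <;> fin_cases x₂ <;> fin_cases y₁ <;> fin_cases y₂ <;>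
    simp [bell, phiPlus, phiMinus, psiPlus, psiMinus, Fin.sum_univ_four, bellSign,
      inv_sqrt_two_mul_self] <;> norm_num

/-- The expectation of `M` in the product of two Bell states. -/
def bellWeight (M : Matrix ((Fin 2 × Fin 2) × (Fin 2 × Fin 2)) ((Fin 2 × Fin 2) × (Fin 2 × Fin 2)) ℂ)
    (u v : Fin 4) : ℂ :=
  star (twoPairs (bell u) (bell v)) ⬝ᵥ (M *ᵥ twoPairs (bell u) (bell v))

lemma bellWeight_eq_sum
    (M : Matrix ((Fin 2 × Fin 2) × (Fin 2 × Fin 2)) ((Fin 2 × Fin 2) × (Fin 2 × Fin 2)) ℂ)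
    (u v : Fin 4) :
    bellWeight M u v = ∑ x, ∑ y, M x y *
      (twoPairs (bell u) (bell v) x * twoPairs (bell u) (bell v) y) := by
  simp only [bellWeight, dotProduct, Matrix.mulVec, Finset.mul_sum]
  refine Finset.sum_congr rfl fun x _ => Finset.sum_congr rfl fun y _ => ?_
  have : star (twoPairs (bell u) (bell v)) x = twoPairs (bell u) (bell v) x := by
    rw [Pi.star_apply, twoPairs, star_mul', star_bell, star_bell]
  rw [this]
  ring

lemma twoPairs_bell_partialTranspose (a b : Fin 4) (x y : (Fin 2 × Fin 2) × (Fin 2 × Fin 2)) :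
    twoPairs (bell a) (bell b) (x.1, y.2) * twoPairs (bell a) (bell b) (y.1, x.2) =
      1 / 4 * ∑ u, ∑ v, (bellSign a u * bellSign b v : ℂ) *
        (twoPairs (bell u) (bell v) x * twoPairs (bell u) (bell v) y) := by
  have h₁ := bell_partialTranspose a (x.1.1, x.2.1) (y.1.1, y.2.1)
  have h₂ := bell_partialTranspose b (x.1.2, x.2.2) (y.1.2, y.2.2)
  have : ∑ u, ∑ v, (bellSign a u * bellSign b v : ℂ) *
        (twoPairs (bell u) (bell v) x * twoPairs (bell u) (bell v) y) =
      (∑ u, (bellSign a u : ℂ) * (bell u (x.1.1, x.2.1) * bell u (y.1.1, y.2.1))) *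
      (∑ v, (bellSign b v : ℂ) * (bell v (x.1.2, x.2.2) * bell v (y.1.2, y.2.2))) := by
    rw [Finset.sum_mul_sum]
    refine Finset.sum_congr rfl fun u _ => Finset.sum_congr rfl fun v _ => ?_
    simp only [twoPairs]
    ring
  rw [this]
  simp only [twoPairs] at h₁ h₂ ⊢
  linear_combination (bell b (x.1.2, y.2.2) * bell b (y.1.2, x.2.2)) * h₁ +
    (1 / 2 * ∑ u, (bellSign a u : ℂ) * (bell u (x.1.1, x.2.1) * bell u (y.1.1, y.2.1))) * h₂

/-- Moves a partial transpose from an operator to the projector it is paired with. -/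
lemma sum_swap_snd {A B : Type} [Fintype A] [Fintype B] (F : A × B → A × B → ℂ) :
    ∑ x, ∑ y, F x y = ∑ x : A × B, ∑ y : A × B, F (x.1, y.2) (y.1, x.2) := by
  simp only [Fintype.sum_prod_type]
  refine Finset.sum_congr rfl fun a _ => ?_
  calc ∑ b, ∑ a', ∑ b', F (a, b) (a', b') = ∑ a', ∑ b, ∑ b', F (a, b) (a', b') :=
        Finset.sum_comm
    _ = ∑ a', ∑ b', ∑ b, F (a, b) (a', b') :=
        Finset.sum_congr rfl fun _ _ => Finset.sum_comm
    _ = _ := Finset.sum_comm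

lemma bellWeight_partialTranspose
    (M : Matrix ((Fin 2 × Fin 2) × (Fin 2 × Fin 2)) ((Fin 2 × Fin 2) × (Fin 2 × Fin 2)) ℂ)
    (a b : Fin 4) :
    bellWeight (partialTranspose M) a b =
      1 / 4 * ∑ u, ∑ v, (bellSign a u * bellSign b v : ℂ) * bellWeight M u v := by
  rw [bellWeight_eq_sum, sum_swap_snd]
  have h (x y : (Fin 2 × Fin 2) × (Fin 2 × Fin 2)) :
      partialTranspose M (x.1, y.2) (y.1, x.2) = M x y := rfl
  simp only [h, twoPairs_bell_partialTranspose, bellWeight_eq_sum, Finset.mul_sum]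
  calc _ = ∑ x, ∑ u, ∑ y, ∑ v, _ := Finset.sum_congr rfl fun x _ => Finset.sum_comm
    _ = ∑ u, ∑ x, ∑ y, ∑ v, _ := Finset.sum_comm
    _ = ∑ u, ∑ x, ∑ v, ∑ y, _ := Finset.sum_congr rfl fun u _ => Finset.sum_congr rfl fun x _ =>
        Finset.sum_comm
    _ = ∑ u, ∑ v, ∑ x, ∑ y, _ := Finset.sum_congr rfl fun u _ => Finset.sum_comm
    _ = _ := Finset.sum_congr rfl fun u _ => Finset.sum_congr rfl fun v _ =>
        Finset.sum_congr rfl fun x _ => Finset.sum_congr rfl fun y _ => by ring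

lemma sum_twoPairs_bell_mul (u v u' v' : Fin 4) :
    star (twoPairs (bell u) (bell v)) ⬝ᵥ twoPairs (bell u') (bell v') =
      if u = u' ∧ v = v' then 1 else 0 := by
  have h : star (twoPairs (bell u) (bell v)) ⬝ᵥ twoPairs (bell u') (bell v') =
      (∑ x, bell u x * bell u' x) * ∑ x, bell v x * bell v' x := by
    simp only [dotProduct, twoPairs, Pi.star_apply, star_mul', star_bell, Finset.sum_mul_sum]
    simp only [Fintype.sum_prod_type]
    refine Finset.sum_congr rfl fun a _ => ?_
    calc _ = ∑ b, ∑ c, ∑ d, _ := Finset.sum_comm' (by simp)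
      _ = _ := Finset.sum_congr rfl fun b _ => Finset.sum_congr rfl fun c _ =>
        Finset.sum_congr rfl fun d _ => by ring
  rw [h, sum_bell_mul_bell, sum_bell_mul_bell]
  split_ifs <;> simp_all

/-- The labels of the Bell states in the first and second pair of the four states `chi`. -/
def chiLabel : Fin 4 → Fin 4 × Fin 4 := ![(0, 0), (1, 1), (2, 1), (3, 1)]

lemma chi_eq (k : Fin 4) : chi k = twoPairs (bell (chiLabel k).1) (bell (chiLabel k).2) := by
  fin_cases k <;> rfl

lemma isOrthonormalFamily_chi : IsOrthonormalFamily chi := by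
  refine ⟨fun k => ?_, fun k l hkl => ?_⟩
  · rw [chi_eq, sum_twoPairs_bell_mul, if_pos ⟨rfl, rfl⟩]
  · rw [chi_eq, chi_eq, sum_twoPairs_bell_mul, if_neg]
    revert k l
    decide

lemma false_of_bell_weights (m : Fin 4 → Fin 4 → Fin 4 → ℝ)
    (hT : ∀ k a b, 0 ≤ ∑ u, ∑ v, bellSign a u * bellSign b v * m k u v)
    (hsum : ∀ u v, ∑ k, m k u v = 1)
    (hone : ∀ k, m k (chiLabel k).1 (chiLabel k).2 = 1) : False := by
  -- The pair `(3, 2)` is the only `(a, b)` whose sign product is `-1` at all four labels. For given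
  -- `k`, this is half the sum of the inequalities `hT k a b` over the pairs `(a, b) ≠ (3, 2)` with
  -- sign product `-1` at `chiLabel k`.
  have key : ∀ k, 4 * m k (chiLabel k).1 (chiLabel k).2 ≤
      ∑ u, ∑ v, (1 - bellSign 3 u * bellSign 2 v / 2) * m k u v := by
    intro k
    have h := hT k
    simp only [Fin.forall_fin_succ, Fin.sum_univ_four, bellSign] at h
    simp at h
    fin_cases k <;> simp [Fin.sum_univ_four, bellSign, chiLabel] at h ⊢ <;> linarith
  have h := Finset.sum_le_sum fun k (_ : k ∈ Finset.univ) => key k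
  simp only [hone] at h
  rw [Finset.sum_comm] at h
  simp_rw [Finset.sum_comm (s := Finset.univ (α := Fin 4)) (f := fun k v => _ * m k _ v),
    ← Finset.mul_sum, hsum] at h
  -- Each row of signs sums to 2, so the right side is `16 - 2 * 2 / 2 = 14`, against 16 on the
  -- left.
  simp [Fin.sum_univ_four, bellSign] at h
  norm_num at h

theorem not_pptDistinguishable_chi : ¬ PPTDistinguishable chi := by
  rintro ⟨M, -, hT, hsum, hone⟩
  refine false_of_bell_weights (fun k u v => (bellWeight (M k) u v).re) (fun k a b => ?_)
    (fun u v => ?_) (fun k => ?_)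
  · have h := (hT k).dotProduct_mulVec_nonneg (twoPairs (bell a) (bell b))
    change 0 ≤ bellWeight (partialTranspose (M k)) a b at h
    rw [bellWeight_partialTranspose] at h
    have h' := (Complex.le_def.1 h).1
    have e : (1 / 4 * ∑ u, ∑ v, (bellSign a u * bellSign b v : ℂ) * bellWeight (M k) u v).re =
        1 / 4 * ∑ u, ∑ v, bellSign a u * bellSign b v * (bellWeight (M k) u v).re := by
      rw [show (1 / 4 : ℂ) = ((1 / 4 : ℝ) : ℂ) by norm_num, Complex.re_ofReal_mul, Complex.re_sum]
      simp only [Complex.re_sum, ← Complex.ofReal_mul, Complex.re_ofReal_mul]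
    rw [e, Complex.zero_re] at h'
    linarith
  · rw [← Complex.re_sum]
    have : ∑ k, bellWeight (M k) u v = 1 := by
      simp only [bellWeight]
      rw [← dotProduct_sum, ← Matrix.sum_mulVec, hsum, Matrix.one_mulVec, sum_twoPairs_bell_mul,
        if_pos ⟨rfl, rfl⟩]
    rw [this, Complex.one_re]
  · have h := hone k
    rw [chi_eq] at h
    simp only [bellWeight, h, Complex.one_re]

/-! ### LOCC measurements are PPT -/

section LocalOperators

variable {A A' B B' : Type}

lemma applyAlice_eq_mulVec [Fintype A] [Fintype B] [DecidableEq B] (K : Matrix A' A ℂ) (ψ : A × B → ℂ) :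
    applyAlice K ψ = (K ⊗ₖ (1 : Matrix B B ℂ)) *ᵥ ψ := by
  ext x
  simp [applyAlice, Matrix.mulVec, dotProduct, Fintype.sum_prod_type, Matrix.one_apply]

lemma applyBob_eq_mulVec [Fintype A] [Fintype B] [DecidableEq A] (K : Matrix B' B ℂ) (ψ : A × B → ℂ) :
    applyBob K ψ = ((1 : Matrix A A ℂ) ⊗ₖ K) *ᵥ ψ := by
  ext x
  simp [applyBob, Matrix.mulVec, dotProduct, Fintype.sum_prod_type, Matrix.one_apply, ite_mul]

lemma conj_kronecker_one_apply [Fintype B] [DecidableEq B] [Fintype A'] (K : Matrix A' A ℂ)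
    (M : Matrix (A' × B) (A' × B) ℂ) (x y : A × B) :
    ((K ⊗ₖ (1 : Matrix B B ℂ))ᴴ * M * (K ⊗ₖ (1 : Matrix B B ℂ))) x y =
      ∑ c, ∑ a, star (K a x.1) * M (a, x.2) (c, y.2) * K c y.1 := by
  simp [Matrix.mul_apply, Fintype.sum_prod_type, Matrix.one_apply, Finset.sum_mul, apply_ite]

lemma conj_one_kronecker_apply [Fintype A] [DecidableEq A] [Fintype B'] (K : Matrix B' B ℂ)
    (M : Matrix (A × B') (A × B') ℂ) (x y : A × B) :
    (((1 : Matrix A A ℂ) ⊗ₖ K)ᴴ * M * ((1 : Matrix A A ℂ) ⊗ₖ K)) x y =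
      ∑ c, ∑ a, star (K a x.2) * M (x.1, a) (y.1, c) * K c y.2 := by
  simp [Matrix.mul_apply, Fintype.sum_prod_type, Matrix.one_apply, Finset.sum_mul, apply_ite, ite_mul]

lemma partialTranspose_conj_kronecker_one [Fintype B] [DecidableEq B] [Fintype A'] (K : Matrix A' A ℂ)
    (M : Matrix (A' × B) (A' × B) ℂ) :
    partialTranspose ((K ⊗ₖ (1 : Matrix B B ℂ))ᴴ * M * (K ⊗ₖ (1 : Matrix B B ℂ))) =
      (K ⊗ₖ (1 : Matrix B B ℂ))ᴴ * partialTranspose M * (K ⊗ₖ (1 : Matrix B B ℂ)) := by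
  ext x y
  simp only [conj_kronecker_one_apply, partialTranspose, Matrix.of_apply]

/-- Transposing Bob's side reverses the two factors around `M`, which leaves a congruence by the
entrywise conjugate of `K`; positivity is therefore still preserved. -/
lemma partialTranspose_conj_one_kronecker [Fintype A] [DecidableEq A] [Fintype B'] (K : Matrix B' B ℂ)
    (M : Matrix (A × B') (A × B') ℂ) :
    partialTranspose (((1 : Matrix A A ℂ) ⊗ₖ K)ᴴ * M * ((1 : Matrix A A ℂ) ⊗ₖ K)) =
      ((1 : Matrix A A ℂ) ⊗ₖ K.map star)ᴴ * partialTranspose M *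
        ((1 : Matrix A A ℂ) ⊗ₖ K.map star) := by
  ext x y
  simp only [conj_one_kronecker_apply, partialTranspose, Matrix.of_apply]
  rw [Finset.sum_comm]
  refine Finset.sum_congr rfl fun a _ => Finset.sum_congr rfl fun b _ => ?_
  simp only [Matrix.map_apply, star_star]
  ring

lemma sum_conj_kronecker_one [DecidableEq A] [Fintype B] [DecidableEq B] [Fintype A'] {n : ℕ} {K : Fin n → Matrix A' A ℂ}
    (hK : ∑ i, (K i)ᴴ * K i = 1) :
    ∑ i, (K i ⊗ₖ (1 : Matrix B B ℂ))ᴴ * (K i ⊗ₖ (1 : Matrix B B ℂ)) = 1 := by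
  have h (i) : (K i ⊗ₖ (1 : Matrix B B ℂ))ᴴ * (K i ⊗ₖ (1 : Matrix B B ℂ)) =
      ((K i)ᴴ * K i) ⊗ₖ (1 : Matrix B B ℂ) := by
    rw [Matrix.conjTranspose_kronecker, ← Matrix.mul_kronecker_mul]
    simp
  simp only [h]
  rw [← Matrix.one_kronecker_one, ← hK]
  ext x y
  simp [Matrix.sum_apply, Finset.sum_mul]

lemma sum_conj_one_kronecker [Fintype A] [DecidableEq A] [DecidableEq B] [Fintype B'] {n : ℕ} {K : Fin n → Matrix B' B ℂ}
    (hK : ∑ i, (K i)ᴴ * K i = 1) :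
    ∑ i, ((1 : Matrix A A ℂ) ⊗ₖ K i)ᴴ * ((1 : Matrix A A ℂ) ⊗ₖ K i) = 1 := by
  have h (i) : ((1 : Matrix A A ℂ) ⊗ₖ K i)ᴴ * ((1 : Matrix A A ℂ) ⊗ₖ K i) =
      (1 : Matrix A A ℂ) ⊗ₖ ((K i)ᴴ * K i) := by
    rw [Matrix.conjTranspose_kronecker, ← Matrix.mul_kronecker_mul]
    simp
  simp only [h]
  rw [← Matrix.one_kronecker_one, ← hK]
  ext x y
  simp [Matrix.sum_apply, Finset.mul_sum]

end LocalOperators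

lemma ofReal_vecNormSq {I : Type} [Fintype I] (ψ : I → ℂ) :
    (vecNormSq ψ : ℂ) = star ψ ⬝ᵥ ψ := by
  simp [vecNormSq, dotProduct, Complex.normSq_eq_conj_mul_self]

lemma star_mulVec_dotProduct {I J : Type} [Fintype I] [Fintype J] (T : Matrix J I ℂ)
    (M : Matrix J J ℂ) (ψ : I → ℂ) :
    star (T *ᵥ ψ) ⬝ᵥ (M *ᵥ (T *ᵥ ψ)) = star ψ ⬝ᵥ ((Tᴴ * M * T) *ᵥ ψ) := by
  rw [Matrix.star_mulVec, Matrix.mulVec_mulVec, ← Matrix.dotProduct_mulVec, Matrix.mulVec_mulVec,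
    Matrix.mul_assoc]

lemma partialTranspose_sum {ι A B : Type} (s : Finset ι) (M : ι → Matrix (A × B) (A × B) ℂ) :
    partialTranspose (∑ i ∈ s, M i) = ∑ i ∈ s, partialTranspose (M i) := by
  ext x y
  simp [partialTranspose, Matrix.sum_apply]

lemma partialTranspose_one {A B : Type} [DecidableEq A] [DecidableEq B] :
    partialTranspose (1 : Matrix (A × B) (A × B) ℂ) = 1 := by
  ext x y
  simp only [partialTranspose, Matrix.of_apply, Matrix.one_apply, Prod.ext_iff]
  congr 1
  simp [eq_comm]

/-- The verdict of an LOCC protocol is the outcome of a measurement with PPT elements. -/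
lemma LOCC.exists_ppt_povm {X : Type} [DecidableEq X] [Fintype X] {A B : Type} (p : LOCC X A B) :
    ∀ [Fintype A] [Fintype B] [DecidableEq A] [DecidableEq B],
      ∃ M : X → Matrix (A × B) (A × B) ℂ,
        (∀ x, (M x).PosSemidef) ∧ (∀ x, (partialTranspose (M x)).PosSemidef) ∧ ∑ x, M x = 1 ∧
          ∀ x ψ, (p.prob x ψ : ℂ) = star ψ ⬝ᵥ (M x *ᵥ ψ) := by
  induction p with
  | done y =>
    intro _ _ _ _
    refine ⟨fun x => if y = x then 1 else 0, fun x => ?_, fun x => ?_, by simp, fun x ψ => ?_⟩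
    · dsimp only
      split_ifs
      exacts [Matrix.PosSemidef.one, Matrix.PosSemidef.zero]
    · dsimp only
      split_ifs
      · rw [partialTranspose_one]
        exact Matrix.PosSemidef.one
      · exact Matrix.PosSemidef.zero
    · rw [LOCC.prob]
      split_ifs with h <;> simp [h, ofReal_vecNormSq]
  | @alice A B A' inst _ n K hK next ih =>
    intro _ _ _ _
    -- The constructor carries its own decidability instance, which enters the identity matrix in
    -- `hK`.
    obtain rfl := Subsingleton.elim inst ‹DecidableEq A›
    classical
    choose M h₁ h₂ h₃ h₄ using fun i => @ih i _ _ _ _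
    -- Heisenberg picture: the elements of the later rounds are pulled back through the Kraus
    -- operators.
    refine ⟨fun x => ∑ i, (K i ⊗ₖ (1 : Matrix B B ℂ))ᴴ * M i x * (K i ⊗ₖ (1 : Matrix B B ℂ)),
      fun x => ?_, fun x => ?_, ?_, fun x ψ => ?_⟩
    · exact Matrix.posSemidef_sum _ fun i _ => (h₁ i x).conjTranspose_mul_mul_same _
    · rw [partialTranspose_sum]
      refine Matrix.posSemidef_sum _ fun i _ => ?_
      rw [partialTranspose_conj_kronecker_one]
      exact (h₂ i x).conjTranspose_mul_mul_same _
    · rw [Finset.sum_comm, ← sum_conj_kronecker_one hK]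
      refine Finset.sum_congr rfl fun i _ => ?_
      rw [← Matrix.sum_mul, ← Matrix.mul_sum, h₃, Matrix.mul_one]
    · rw [LOCC.prob, Complex.ofReal_sum, Matrix.sum_mulVec, dotProduct_sum]
      refine Finset.sum_congr rfl fun i _ => ?_
      rw [h₄, applyAlice_eq_mulVec, star_mulVec_dotProduct]
  | @bob A B B' inst _ n K hK next ih =>
    intro _ _ _ _
    obtain rfl := Subsingleton.elim inst ‹DecidableEq B›
    classical
    choose M h₁ h₂ h₃ h₄ using fun i => @ih i _ _ _ _
    refine ⟨fun x => ∑ i, ((1 : Matrix A A ℂ) ⊗ₖ K i)ᴴ * M i x * ((1 : Matrix A A ℂ) ⊗ₖ K i),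
      fun x => ?_, fun x => ?_, ?_, fun x ψ => ?_⟩
    · exact Matrix.posSemidef_sum _ fun i _ => (h₁ i x).conjTranspose_mul_mul_same _
    · rw [partialTranspose_sum]
      refine Matrix.posSemidef_sum _ fun i _ => ?_
      rw [partialTranspose_conj_one_kronecker]
      exact (h₂ i x).conjTranspose_mul_mul_same _
    · rw [Finset.sum_comm, ← sum_conj_one_kronecker hK]
      refine Finset.sum_congr rfl fun i _ => ?_
      rw [← Matrix.sum_mul, ← Matrix.mul_sum, h₃, Matrix.mul_one]
    · rw [LOCC.prob, Complex.ofReal_sum, Matrix.sum_mulVec, dotProduct_sum]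
      refine Finset.sum_congr rfl fun i _ => ?_
      rw [h₄, applyBob_eq_mulVec, star_mulVec_dotProduct]

theorem PerfectLSD.pptDistinguishable {X A B : Type} [DecidableEq X] [Fintype X] [Fintype A]
    [Fintype B] [DecidableEq A] [DecidableEq B] {ψ : X → A × B → ℂ} (h : PerfectLSD ψ) :
    PPTDistinguishable ψ := by
  obtain ⟨p, hp⟩ := h
  obtain ⟨M, h₁, h₂, h₃, h₄⟩ := p.exists_ppt_povm
  exact ⟨M, h₁, h₂, h₃, fun x => by rw [← h₄, hp x, Complex.ofReal_one]⟩

lemma sum_vecNormSq_applyAlice {A A' B : Type} [Fintype A] [DecidableEq A] [Fintype A'] [Fintype B]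
    {n : ℕ} {K : Fin n → Matrix A' A ℂ} (hK : ∑ i, (K i)ᴴ * K i = 1) (ψ : A × B → ℂ) :
    ∑ i, vecNormSq (applyAlice (K i) ψ) = vecNormSq ψ := by
  classical
  apply Complex.ofReal_injective
  have h := congr_arg (fun M => star ψ ⬝ᵥ (M *ᵥ ψ)) (sum_conj_kronecker_one (B := B) hK)
  simp only [Matrix.sum_mulVec, dotProduct_sum, Matrix.one_mulVec] at h
  rw [Complex.ofReal_sum, ofReal_vecNormSq, ← h]
  refine Finset.sum_congr rfl fun i _ => ?_
  rw [ofReal_vecNormSq, applyAlice_eq_mulVec]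
  simpa using star_mulVec_dotProduct (K i ⊗ₖ (1 : Matrix B B ℂ)) 1 ψ

lemma sum_vecNormSq_applyBob {A B B' : Type} [Fintype A] [Fintype B] [DecidableEq B] [Fintype B']
    {n : ℕ} {K : Fin n → Matrix B' B ℂ} (hK : ∑ i, (K i)ᴴ * K i = 1) (ψ : A × B → ℂ) :
    ∑ i, vecNormSq (applyBob (K i) ψ) = vecNormSq ψ := by
  classical
  apply Complex.ofReal_injective
  have h := congr_arg (fun M => star ψ ⬝ᵥ (M *ᵥ ψ)) (sum_conj_one_kronecker (A := A) hK)
  simp only [Matrix.sum_mulVec, dotProduct_sum, Matrix.one_mulVec] at h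
  rw [Complex.ofReal_sum, ofReal_vecNormSq, ← h]
  refine Finset.sum_congr rfl fun i _ => ?_
  rw [ofReal_vecNormSq, applyBob_eq_mulVec]
  simpa using star_mulVec_dotProduct ((1 : Matrix A A ℂ) ⊗ₖ K i) 1 ψ

/-! ### Marking states as shifts and characters over bits -/

/-- The sign `(-1) ^ a`. -/
def bitSign (a : Fin 2) : ℂ := if a = 0 then 1 else -1

lemma bitSign_add (a b : Fin 2) : bitSign (a + b) = bitSign a * bitSign b := by
  fin_cases a <;> fin_cases b <;> simp [bitSign]

lemma star_bitSign (a : Fin 2) : star (bitSign a) = bitSign a := by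
  fin_cases a <;> simp [bitSign]

lemma bitSign_mul_self (a : Fin 2) : bitSign a * bitSign a = 1 := by
  fin_cases a <;> simp [bitSign]

/-- The bilinear character `(-1) ^ (r · q)` on pairs of bits. -/
def pairSign (r q : Fin 2 × Fin 2) : ℂ := bitSign (r.1 * q.1 + r.2 * q.2)

lemma pairSign_add_left (r s q : Fin 2 × Fin 2) :
    pairSign (r + s) q = pairSign r q * pairSign s q := by
  simp only [pairSign, ← bitSign_add]
  congr 1
  revert r s q
  decide

lemma pairSign_add_right (r q t : Fin 2 × Fin 2) :
    pairSign r (q + t) = pairSign r q * pairSign r t := by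
  simp only [pairSign, ← bitSign_add]
  congr 1
  revert r q t
  decide

lemma star_pairSign (r q : Fin 2 × Fin 2) : star (pairSign r q) = pairSign r q :=
  star_bitSign _

lemma sum_pairSign_right (r : Fin 2 × Fin 2) :
    ∑ q, pairSign r q = if r = 0 then 4 else 0 := by
  obtain ⟨a, b⟩ := r
  fin_cases a <;> fin_cases b <;>
    simp [pairSign, bitSign, Fintype.sum_prod_type]

lemma sum_pairSign_left (q : Fin 2 × Fin 2) :
    ∑ r, pairSign r q = if q = 0 then 4 else 0 := by
  rw [← sum_pairSign_right]
  simp only [pairSign, mul_comm]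

/-- Whether the first pair of the states `chi` is bit-flipped. -/
def bitX : Fin 4 → Fin 2 := ![0, 0, 1, 1]

/-- Whether the first pair of the states `chi` carries a phase. -/
def bitZ : Fin 4 → Fin 2 := ![0, 1, 0, 1]

/-- Whether the second pair of the states `chi` carries a phase. -/
def bitT : Fin 4 → Fin 2 := ![0, 1, 1, 1]

/-- The second pair is never in a flipped Bell state, hence the `0` in the shift. -/
lemma chi_apply (k : Fin 4) (a b : Fin 2 × Fin 2) :
    chi k (a, b) = 1 / 2 *
      if b = a + (bitX k, 0) then bitSign (bitZ k * a.1 + bitT k * a.2) else 0 := by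
  obtain ⟨a₁, a₂⟩ := a
  obtain ⟨b₁, b₂⟩ := b
  fin_cases k <;> fin_cases a₁ <;> fin_cases a₂ <;> fin_cases b₁ <;> fin_cases b₂ <;>
    simp [chi, twoPairs, phiPlus, phiMinus, psiPlus, psiMinus, bitX, bitZ, bitT, bitSign,
      inv_sqrt_two_mul_self, -mul_inv_rev]

/-- The bit flips of the Bell pairs in a marking state. -/
def markShift (f : Fin 4 ↪ Fin 4) : Fin 4 → Fin 2 × Fin 2 := fun j => (bitX (f j), 0)

/-- The phase of a marking state at a basis vector of Alice. -/
def markPhase (f : Fin 4 ↪ Fin 4) (a : Fin 4 → Fin 2 × Fin 2) : ℂ :=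
  bitSign (∑ j, (bitZ (f j) * (a j).1 + bitT (f j) * (a j).2))

lemma markingState_chi_apply (f : Fin 4 ↪ Fin 4) (a b : Fin 4 → Fin 2 × Fin 2) :
    markingState chi f (a, b) = 1 / 16 * if b = a + markShift f then markPhase f a else 0 := by
  simp only [markingState, chi_apply, Finset.prod_mul_distrib, Finset.prod_ite_zero]
  congr 1
  · norm_num
  · simp only [Finset.mem_univ, true_implies, funext_iff, Pi.add_apply, markShift, markPhase,
      Fin.sum_univ_four, Fin.prod_univ_four, bitSign_add]

lemma vecNormSq_markingState_chi (f : Fin 4 ↪ Fin 4) : vecNormSq (markingState chi f) = 1 := by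
  have h (a : Fin 4 → Fin 2 × Fin 2) : Complex.normSq (markPhase f a) = 1 := by
    rw [markPhase, bitSign]
    split_ifs <;> simp
  simp [vecNormSq, Fintype.sum_prod_type, markingState_chi_apply, apply_ite Complex.normSq, h]
  norm_num

/-! ### The syndrome and the local measurement -/

/-- The decomposition of the eight bits of a party into the three bits measured in the computational
basis, the three bits that are kept, and the two bits measured in the conjugate basis. -/
def codeEquiv : (Fin 4 → Fin 2 × Fin 2) ≃
    (Fin 2 × Fin 2 × Fin 2) × (Fin 3 → Fin 2) × (Fin 2 × Fin 2) where
  -- Copy 0 is kept whole. Each parity joins a first bit of one of the copies 1, 2, 3 to a second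
  -- bit of another, cyclically.
  toFun a := (((a 1).1 + (a 2).2, (a 2).1 + (a 3).2, (a 3).1 + (a 1).2),
    ![(a 0).1, (a 0).2, (a 3).1 + (a 2).1 + (a 1).1], ((a 2).1, (a 1).1))
  invFun g := ![(g.2.1 0, g.2.1 1), (g.2.2.2, g.1.2.2 + g.2.1 2 + g.2.2.1 + g.2.2.2),
    (g.2.2.1, g.1.1 + g.2.2.2), (g.2.1 2 + g.2.2.1 + g.2.2.2, g.1.2.1 + g.2.2.1)]
  left_inv a := by
    have h : ∀ x y z : Fin 2 × Fin 2,
        (x.1, z.1 + x.2 + (z.1 + y.1 + x.1) + y.1 + x.1) = x ∧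
        (y.1, x.1 + y.2 + x.1) = y ∧ (z.1 + y.1 + x.1 + y.1 + x.1, y.1 + z.2 + y.1) = z := by
      decide
    obtain ⟨h₁, h₂, h₃⟩ := h (a 1) (a 2) (a 3)
    funext j
    fin_cases j
    exacts [rfl, h₁, h₂, h₃]
  right_inv g := by
    have h : ∀ (p : Fin 2 × Fin 2 × Fin 2) (w : Fin 2) (q : Fin 2 × Fin 2),
        (q.2 + (p.1 + q.2), q.1 + (p.2.1 + q.1), w + q.1 + q.2 + (p.2.2 + w + q.1 + q.2)) = p ∧
        w + q.1 + q.2 + q.1 + q.2 = w := by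
      decide
    obtain ⟨h₁, h₂⟩ := h g.1 (g.2.1 2) g.2.2
    refine Prod.ext h₁ (Prod.ext ?_ rfl)
    funext j
    fin_cases j
    exacts [rfl, rfl, h₂]

lemma codeEquiv_add (a b : Fin 4 → Fin 2 × Fin 2) :
    codeEquiv (a + b) = codeEquiv a + codeEquiv b := by
  simp only [codeEquiv, Equiv.coe_fn_mk, Pi.add_apply, Prod.fst_add, Prod.snd_add, Prod.mk_add_mk,
    Matrix.cons_add_cons, Matrix.empty_add_empty]
  simp only [add_assoc, add_left_comm]

/-- The bits that Alice and Bob learn about a marking state. -/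
def markSyndrome (f : Fin 4 ↪ Fin 4) : (Fin 2 × Fin 2 × Fin 2) × (Fin 2 × Fin 2) :=
  ((bitX (f 1), bitX (f 2), bitX (f 3)),
    (bitZ (f 2) + bitZ (f 3) + bitT (f 3) + bitT (f 1),
      bitZ (f 1) + bitZ (f 3) + bitT (f 2) + bitT (f 1)))

set_option synthInstance.maxHeartbeats 400000 in
set_option synthInstance.maxSize 4096 in
-- Exactly two states are flipped, so three flip bits fix the fourth and leave four arrangements,
-- which the two phase bits separate.
lemma markSyndrome_injective : Function.Injective markSyndrome := by
  -- Constraints are interleaved with the quantifiers so that the exhaustive check is cut off early.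
  have key : ∀ a b : Fin 4, a ≠ b → ∀ c, a ≠ c → b ≠ c → ∀ d, a ≠ d → b ≠ d → c ≠ d →
      ∀ a' b' : Fin 4, a' ≠ b' → bitX b = bitX b' → ∀ c', a' ≠ c' → b' ≠ c' → bitX c = bitX c' →
      ∀ d', a' ≠ d' → b' ≠ d' → c' ≠ d' → bitX d = bitX d' →
      bitZ c + bitZ d + bitT d + bitT b = bitZ c' + bitZ d' + bitT d' + bitT b' →
      bitZ b + bitZ d + bitT c + bitT b = bitZ b' + bitZ d' + bitT c' + bitT b' →
      a = a' ∧ b = b' ∧ c = c' ∧ d = d' := by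
    decide +kernel
  intro f g h
  simp only [markSyndrome, Prod.mk.injEq] at h
  obtain ⟨⟨h₁, h₂, h₃⟩, h₄, h₅⟩ := h
  have hf (i j : Fin 4) (hij : i ≠ j := by decide) : f i ≠ f j := f.injective.ne hij
  have hg (i j : Fin 4) (hij : i ≠ j := by decide) : g i ≠ g j := g.injective.ne hij
  obtain ⟨e₀, e₁, e₂, e₃⟩ := key (f 0) (f 1) (hf 0 1) (f 2) (hf 0 2) (hf 1 2) (f 3) (hf 0 3)
    (hf 1 3) (hf 2 3) (g 0) (g 1) (hg 0 1) h₁ (g 2) (hg 0 2) (hg 1 2) h₂ (g 3) (hg 0 3) (hg 1 3)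
    (hg 2 3) h₃ h₄ h₅
  ext j
  fin_cases j <;> simp [e₀, e₁, e₂, e₃]

/-- The second bits of the shift vanish, so each parity reads a single flip bit. -/
lemma codeEquiv_markShift_fst (f : Fin 4 ↪ Fin 4) :
    (codeEquiv (markShift f)).1 = (markSyndrome f).1 := by
  simp [codeEquiv, markShift, markSyndrome]

open scoped Fin.CommRing in
-- The exponent of the phase is linear over the two-element field; the coefficients of `q` in it are
-- the last two syndrome bits.
lemma markPhase_codeEquiv_symm (f : Fin 4 ↪ Fin 4) (p : Fin 2 × Fin 2 × Fin 2) (w : Fin 3 → Fin 2)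
    (q : Fin 2 × Fin 2) :
    markPhase f (codeEquiv.symm (p, w, q)) =
      markPhase f (codeEquiv.symm (p, w, 0)) * pairSign (markSyndrome f).2 q := by
  simp only [markPhase, pairSign, ← bitSign_add, Fin.sum_univ_four, codeEquiv, Equiv.coe_fn_symm_mk,
    markSyndrome, Prod.fst_zero, Prod.snd_zero, Matrix.cons_val]
  congr 1
  ring

/-- The Kraus operators of the measurement by which each party reads off five bits and keeps three
qubits. -/
def markKraus (s : (Fin 2 × Fin 2 × Fin 2) × (Fin 2 × Fin 2)) :
    Matrix (Fin 3 → Fin 2) (Fin 4 → Fin 2 × Fin 2) ℂ :=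
  Matrix.of fun w a =>
    if (codeEquiv a).1 = s.1 then
      if (codeEquiv a).2.1 = w then 1 / 2 * pairSign s.2 (codeEquiv a).2.2 else 0
    else 0

/-- Orthogonality of the four characters of pairs of bits, which the factor `1 / 2` normalizes. -/
lemma markKraus_complete : ∑ s, (markKraus s)ᴴ * markKraus s = 1 := by
  ext a b
  have hch (q q' : Fin 2 × Fin 2) :
      ∑ r, 1 / 2 * pairSign r q * (1 / 2 * pairSign r q') = if q = q' then 1 else 0 := by
    have : ∀ q q' : Fin 2 × Fin 2, q + q' = 0 ↔ q = q' := by decide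
    calc _ = 1 / 4 * ∑ r, pairSign r (q + q') := by
          rw [Finset.mul_sum]
          refine Finset.sum_congr rfl fun r _ => ?_
          rw [pairSign_add_right]
          ring
      _ = _ := by
          simp only [sum_pairSign_left, this]
          split_ifs <;> norm_num
  have hab : a = b ↔ (codeEquiv b).1 = (codeEquiv a).1 ∧ (codeEquiv a).2.1 = (codeEquiv b).2.1 ∧
      (codeEquiv a).2.2 = (codeEquiv b).2.2 := by
    rw [← codeEquiv.apply_eq_iff_eq, Prod.ext_iff, Prod.ext_iff (x := (codeEquiv a).2),
      eq_comm (a := (codeEquiv b).1)]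
  have hs (s : (Fin 2 × Fin 2 × Fin 2) × (Fin 2 × Fin 2)) :
      ((markKraus s)ᴴ * markKraus s) a b = if (codeEquiv a).1 = s.1 then
        if (codeEquiv b).1 = s.1 ∧ (codeEquiv a).2.1 = (codeEquiv b).2.1 then
          1 / 2 * pairSign s.2 (codeEquiv a).2.2 * (1 / 2 * pairSign s.2 (codeEquiv b).2.2)
        else 0 else 0 := by
    simp only [Matrix.mul_apply, Matrix.conjTranspose_apply, markKraus, Matrix.of_apply,
      apply_ite star, star_mul', star_pairSign, star_zero, ite_mul, mul_ite, mul_zero, zero_mul]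
    by_cases h₁ : (codeEquiv a).1 = s.1 <;> by_cases h₂ : (codeEquiv b).1 = s.1 <;>
      simp only [h₁, h₂, if_true, if_false, true_and, false_and, Finset.sum_const_zero,
        Finset.sum_ite_eq, Finset.mem_univ]
    rw [show star (1 / 2 : ℂ) = 1 / 2 by simp]
  simp only [Matrix.sum_apply, hs, Matrix.one_apply, hab]
  rw [Fintype.sum_prod_type_right]
  simp only [Finset.sum_ite_eq, Finset.mem_univ, if_true]
  by_cases h₁ : (codeEquiv b).1 = (codeEquiv a).1 <;>
    by_cases h₂ : (codeEquiv a).2.1 = (codeEquiv b).2.1 <;>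
      simp only [h₁, h₂, hch, true_and, false_and, and_false, if_true, if_false,
        Finset.sum_const_zero]

/-- The state after both parties have measured. -/
lemma applyBob_applyAlice_markingState (f : Fin 4 ↪ Fin 4)
    (s t : (Fin 2 × Fin 2 × Fin 2) × (Fin 2 × Fin 2)) (w w' : Fin 3 → Fin 2) :
    applyBob (markKraus t) (applyAlice (markKraus s) (markingState chi f)) (w, w') =
      if markSyndrome f = s + t then
        if w' = w + (codeEquiv (markShift f)).2.1 then
          1 / 16 * pairSign t.2 (codeEquiv (markShift f)).2.2 *
            markPhase f (codeEquiv.symm (s.1, w, 0))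
        else 0
      else 0 := by
  obtain ⟨p, r⟩ := s
  obtain ⟨p', r'⟩ := t
  have h₁ : applyBob (markKraus (p', r')) (applyAlice (markKraus (p, r)) (markingState chi f))
      (w, w') = 1 / 16 * ∑ a, markKraus (p, r) w a * markKraus (p', r') w' (a + markShift f) *
        markPhase f a := by
    simp only [applyBob, applyAlice, markingState_chi_apply, Finset.mul_sum]
    rw [Finset.sum_comm]
    simp [mul_ite]
    exact Finset.sum_congr rfl fun a _ => by ring
  set x := codeEquiv (markShift f) with hx
  have hp : x.1 = (markSyndrome f).1 := codeEquiv_markShift_fst f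
  -- In code coordinates `p` and `w` are pinned. The two measurement characters and the phase merge
  -- into one character of `q`, whose sum is 4 if it is trivial and 0 otherwise.
  have h₂ : ∑ a, markKraus (p, r) w a * markKraus (p', r') w' (a + markShift f) *
        markPhase f a = ∑ q, if p + x.1 = p' then if w + x.2.1 = w' then
          1 / 4 * pairSign r' x.2.2 * markPhase f (codeEquiv.symm (p, w, 0)) *
            pairSign (r + r' + (markSyndrome f).2) q else 0 else 0 := by
    rw [← codeEquiv.symm.sum_comp]
    simp only [markKraus, Matrix.of_apply, codeEquiv_add, Equiv.apply_symm_apply, ← hx,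
      Prod.fst_add, Prod.snd_add, ite_mul, zero_mul]
    rw [Fintype.sum_prod_type, Finset.sum_eq_single p (fun b _ hb => by simp [hb]) (by simp)]
    rw [Fintype.sum_prod_type, Finset.sum_eq_single w (fun b _ hb => by simp [hb]) (by simp)]
    refine Finset.sum_congr rfl fun q _ => ?_
    simp only [if_true]
    split_ifs
    · rw [markPhase_codeEquiv_symm, pairSign_add_left, pairSign_add_left, pairSign_add_right]
      ring
    · simp
    · simp
  have hs : markSyndrome f = (p, r) + (p', r') ↔
      p + x.1 = p' ∧ r + r' + (markSyndrome f).2 = 0 := by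
    have e₁ : ∀ a b c : Fin 2 × Fin 2 × Fin 2, c = a + b ↔ a + c = b := by decide
    have e₂ : ∀ a b : Fin 2 × Fin 2, b = a ↔ a + b = 0 := by decide
    rw [Prod.ext_iff, hp, Prod.fst_add, Prod.snd_add, e₁, e₂]
  rw [h₁, h₂]
  by_cases hpx : p + x.1 = p'
  · by_cases hw : w + x.2.1 = w'
    · simp only [hs, hpx, hw, if_true, true_and, ← Finset.mul_sum, sum_pairSign_right]
      split_ifs <;> ring
    · simp [hpx, hw, Ne.symm hw]
  · simp only [hs, hpx, false_and, if_false, Finset.sum_const_zero, mul_zero]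

/-! ### The remaining ebits and the protocol -/

lemma isEbits_of_signed_shift (n : ℕ) (ψ : (Fin n → Fin 2) × (Fin n → Fin 2) → ℂ) (c : ℂ)
    (μ : (Fin n → Fin 2) → ℂ) (hμ : ∀ w, star (μ w) * μ w = 1) (y : Fin n → Fin 2)
    (h : ∀ w w', ψ (w, w') = if w' = w + y then c * μ w else 0) : IsEbits n ψ := by
  -- Alice's isometry is the diagonal phase, Bob's the translation by `y`; the power of `√2` cancels
  -- the normalization of `eprPairs`.
  refine ⟨Matrix.diagonal μ, Matrix.of fun w' w => if w' = w + y then 1 else 0,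
    c * (Real.sqrt 2 : ℂ) ^ n, ?_, ?_, ?_⟩
  · rw [Matrix.diagonal_conjTranspose, Matrix.diagonal_mul_diagonal, ← Matrix.diagonal_one]
    congr 1
    exact funext hμ
  · ext w w'
    simp [Matrix.mul_apply, Matrix.one_apply, eq_comm]
  · have h2 : (Real.sqrt 2 : ℂ) ≠ 0 := by simp
    ext ⟨w, w'⟩
    rw [h]
    simp only [Pi.smul_apply, smul_eq_mul, Matrix.mulVec, dotProduct, Fintype.sum_prod_type,
      Matrix.kroneckerMap_apply, Matrix.diagonal_apply, Matrix.of_apply, eprPairs]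
    simp only [mul_ite, ite_mul, mul_one, mul_zero, zero_mul, Finset.sum_ite_eq, Finset.mem_univ,
      if_true]
    rw [Finset.sum_eq_single w (fun b _ hb => by simp [hb.symm]) (by simp)]
    simp only [if_true]
    split_ifs <;> simp [field]

lemma isEbits_markingState_measured (f : Fin 4 ↪ Fin 4)
    (s t : (Fin 2 × Fin 2 × Fin 2) × (Fin 2 × Fin 2)) :
    IsEbits 3 (applyBob (markKraus t) (applyAlice (markKraus s) (markingState chi f))) := by
  -- Impossible outcome pairs get the scalar 0, so they too count as three ebits, with weight zero.
  refine isEbits_of_signed_shift 3 _ (if markSyndrome f = s + t then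
    1 / 16 * pairSign t.2 (codeEquiv (markShift f)).2.2 else 0)
    (fun w => markPhase f (codeEquiv.symm (s.1, w, 0))) (fun w => ?_)
    (codeEquiv (markShift f)).2.1 fun w w' => ?_
  · rw [markPhase, star_bitSign, bitSign_mul_self]
  · rw [applyBob_applyAlice_markingState]
    split_ifs <;> simp

/-- An enumeration of the measurement outcomes of a party. -/
def outcomeEquiv : Fin (Fintype.card ((Fin 2 × Fin 2 × Fin 2) × (Fin 2 × Fin 2))) ≃
    (Fin 2 × Fin 2 × Fin 2) × (Fin 2 × Fin 2) :=
  (Fintype.equivFin _).symm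

lemma sum_markKraus_outcomeEquiv :
    ∑ i, (markKraus (outcomeEquiv i))ᴴ * markKraus (outcomeEquiv i) = 1 := by
  rw [outcomeEquiv.sum_comp (fun s => (markKraus s)ᴴ * markKraus s), markKraus_complete]

instance : Nonempty (Fin 4 ↪ Fin 4) := ⟨Function.Embedding.refl _⟩

/-- Both parties measure five bits; the sum of their outcomes determines the arrangement. -/
def markProtocol : LOCC (Fin 4 ↪ Fin 4) (Fin 4 → Fin 2 × Fin 2) (Fin 4 → Fin 2 × Fin 2) :=
  .alice _ _ (fun i => markKraus (outcomeEquiv i)) sum_markKraus_outcomeEquiv fun i =>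
    .bob _ _ (fun j => markKraus (outcomeEquiv j)) sum_markKraus_outcomeEquiv fun j =>
      .done (Function.invFun markSyndrome (outcomeEquiv i + outcomeEquiv j))

lemma sum_vecNormSq_measured (f : Fin 4 ↪ Fin 4) :
    ∑ i, ∑ j, vecNormSq (applyBob (markKraus (outcomeEquiv j))
      (applyAlice (markKraus (outcomeEquiv i)) (markingState chi f))) = 1 := by
  simp only [sum_vecNormSq_applyBob sum_markKraus_outcomeEquiv]
  rw [sum_vecNormSq_applyAlice sum_markKraus_outcomeEquiv, vecNormSq_markingState_chi]

lemma markProtocol_identifies : markProtocol.Identifies (markingState chi) := by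
  intro f
  -- With 1 written as the total weight of all branches, it suffices that every branch either has
  -- the right verdict or vanishes.
  rw [← sum_vecNormSq_measured f]
  simp only [markProtocol, LOCC.prob]
  refine Finset.sum_congr rfl fun i _ => Finset.sum_congr rfl fun j _ => ?_
  by_cases h : markSyndrome f = outcomeEquiv i + outcomeEquiv j
  · rw [← h, Function.leftInverse_invFun markSyndrome_injective, if_pos rfl]
  · have : vecNormSq (applyBob (markKraus (outcomeEquiv j))
        (applyAlice (markKraus (outcomeEquiv i)) (markingState chi f))) = 0 :=
      Finset.sum_eq_zero fun ⟨w, w'⟩ _ => by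
        rw [applyBob_applyAlice_markingState, if_neg h, map_zero]
    rw [this, ite_self]

lemma markProtocol_leavesEbits (f : Fin 4 ↪ Fin 4) :
    markProtocol.LeavesEbits (markingState chi f) 3 := by
  refine ⟨fun i => ∑ j, vecNormSq (applyBob (markKraus (outcomeEquiv j))
      (applyAlice (markKraus (outcomeEquiv i)) (markingState chi f))) * (3 : ℕ), ?_, fun i =>
    ⟨_, rfl, fun j => Or.inr ⟨3, isEbits_markingState_measured f _ _, rfl⟩⟩⟩
  simp only [← Finset.sum_mul]
  rw [sum_vecNormSq_measured]
  norm_num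

/-- Perfect LSM does not imply perfect LSD; the four states `chi` witness this: some LOCC protocol
marks them perfectly and leaves 3 ebits on average over the 24 equally likely arrangements, while
not even PPT POVMs distinguish them perfectly. -/
theorem theorem2 :
    (¬ ∀ (A B : Type) [Fintype A] [Fintype B] (k : ℕ) (ψ : Fin k → A × B → ℂ),
        IsOrthonormalFamily ψ → PerfectLSM ψ → PerfectLSD ψ) ∧
    IsOrthonormalFamily chi ∧
    PerfectLSM chi ∧
    (∃ p : LOCC (Fin 4 ↪ Fin 4) (Fin 4 → Fin 2 × Fin 2) (Fin 4 → Fin 2 × Fin 2),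
      p.Identifies (markingState chi) ∧
      ∃ c : (Fin 4 ↪ Fin 4) → ℝ,
        (∀ f, p.LeavesEbits (markingState chi f) (c f)) ∧ (1 / 24 : ℝ) * ∑ f, c f = 3) ∧
    ¬ PerfectLSD chi ∧
    ¬ PPTDistinguishable chi := by
  have hLSM : PerfectLSM chi := ⟨markProtocol, markProtocol_identifies⟩
  have hLSD : ¬ PerfectLSD chi := fun h => not_pptDistinguishable_chi h.pptDistinguishable
  refine ⟨fun h => hLSD (h _ _ 4 chi isOrthonormalFamily_chi hLSM), isOrthonormalFamily_chi, hLSM,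
    ⟨markProtocol, markProtocol_identifies, fun _ => 3, markProtocol_leavesEbits, ?_⟩, hLSD,
    not_pptDistinguishable_chi⟩
  rw [Finset.sum_const, Finset.card_univ, Fintype.card_embedding_eq]
  norm_num [Nat.descFactorial]

end
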